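/- For a real number $t$ and an integer $m\ge 1$ let $\pi(t;m,1)$ be the number of primes $p\le t$ with $p\equiv 1 \pmod m$, and let $\varphi$ be Euler's totient function. There are absolute constants $C>0$ and $0<\epsilon_0<1$ such that for every $\epsilon$ with $0<\epsilon<\epsilon_0$ there is $x_0=x_0(\epsilon)$ such that for all real $x\ge x_0$ $$\Bigg|\sum_{1\le m\leqslant x^{1-\epsilon}}\varphi(m)\int_{2}^{m^{1+\epsilon}}\frac{\pi(t;m,1)}{(t-1)^2}\,dt\int_{m^{1+\epsilon}}^{x}\frac{\pi(t;m,1)}{(t-1)^2}\,dt\Bigg|\leqslant C\Big(\epsilon(\log \epsilon^{-1})^2\log x+(\log\log x)^2\Big).$$ -/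

import Mathlib

/-- `primesMod t k a` is `π(t; k, a)`: the number of primes `p ≤ t` with `p ≡ a (mod k)`,
for a real number `t`. -/
noncomputable def primesMod (t : ℝ) (k a : ℕ) : ℕ :=
  ((Finset.Icc 1 ⌊t⌋₊).filter fun p => p.Prime ∧ p ≡ a [MOD k]).card

/-- The sum over the integers `1 ≤ m ≤ x ^ (1 - ε)` of
`φ(m) · ∫_2^{m^{1+ε}} π(t;m,1)/(t-1)² dt · ∫_{m^{1+ε}}^x π(t;m,1)/(t-1)² dt`. -/
noncomputable def crossSum (ε x : ℝ) : ℝ :=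
  ∑ m ∈ Finset.Icc 1 ⌊x ^ (1 - ε)⌋₊,
    (Nat.totient m : ℝ) *
      (∫ t in (2 : ℝ)..((m : ℝ) ^ (1 + ε)), (primesMod t m 1 : ℝ) / (t - 1) ^ 2) *
      (∫ t in ((m : ℝ) ^ (1 + ε))..x, (primesMod t m 1 : ℝ) / (t - 1) ^ 2)

/-! The only deep input is a Brun–Titchmarsh bound for primes `m * k + 1`, uniform in `m`
(`card_prime_mul_add_one_le`), proved with Selberg's sieve. It is used twice, in two directions. For
fixed `m` it bounds `φ(m)` times the second integral by a difference of values of `log log (t / m)`,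
which is `O(log ε⁻¹ + log (log x / log m))`; the first term arises because `m ^ (1 + ε) / m = m ^
ε`. The first integral is at most the sum of `1 / (p - 1)` over primes `p = m * k + 1` with `k ≤ m ^
ε`. No good bound is available for a single `m`, so one averages over a dyadic block of `m`: for
fixed `k` the sieve counts the `m` with `m * k + 1` prime, and `∑ 1 / φ(k) ≪ 1 + log K` makes a
block contribute `O(ε + 1 / (j + 1))` (`sum_sumInvPrimes_dyadic_le`). Summing over the `O(log x)`
blocks gives `O(ε log ε⁻¹ log x)` plus terms of order at most `√(log x) log log x` for fixed `ε`.
The latter are below `ε log x` once `x` is large in terms of `ε`, so the `(log log x)²` of the claim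
is not needed. -/

open Finset ArithmeticFunction MeasureTheory
open scoped ArithmeticFunction.Moebius

/-! ### Selberg's upper bound sieve -/

namespace BoundingSieve

/-- The sum of the Selberg terms `g l` over the divisors `l ≤ Z` of the sifting product. -/
noncomputable def selbergSum (s : BoundingSieve) (Z : ℕ) : ℝ :=
  ∑ l ∈ s.prodPrimes.divisors, if l ≤ Z then s.selbergTerms l else 0

/-- The optimal weights of the Selberg sieve of level `Z`. -/
noncomputable def selbergWeights (s : BoundingSieve) (Z d : ℕ) : ℝ :=
  (s.nu d)⁻¹ * ((μ d : ℝ) *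
    (∑ l ∈ s.prodPrimes.divisors, if d ∣ l ∧ l ≤ Z then s.selbergTerms l else 0)) /
    s.selbergSum Z

variable {s : BoundingSieve}

theorem selbergSum_pos {Z : ℕ} (hZ : 1 ≤ Z) : 0 < s.selbergSum Z := by
  unfold selbergSum
  refine sum_pos' (fun l hl => ?_) ⟨1, ?_, ?_⟩
  · split_ifs
    · exact (selbergTerms_pos (Nat.dvd_of_mem_divisors hl)).le
    · exact le_rfl
  · simpa using s.prodPrimes_ne_zero
  · simpa [hZ] using selbergTerms_pos (s := s) (one_dvd _)

theorem selbergWeights_one {Z : ℕ} (hZ : 1 ≤ Z) : s.selbergWeights Z 1 = 1 := by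
  have := (selbergSum_pos (s := s) hZ).ne'
  rw [selbergWeights, s.nu_mult.map_one]
  simp only [inv_one, moebius_apply_one, Int.cast_one, one_mul, isUnit_one, IsUnit.dvd, true_and]
  exact div_self this

theorem selbergWeights_eq_zero {Z d : ℕ} (hd : Z < d) : s.selbergWeights Z d = 0 := by
  rw [selbergWeights, sum_eq_zero]
  · simp
  intro l hl
  rw [if_neg]
  rintro ⟨h1, h2⟩
  have := Nat.le_of_dvd (Nat.pos_of_mem_divisors hl) h1
  omega

/-- The numerator is a subsum of `selbergSum`. This is cruder than the classical bound by `1`, but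
suffices for a level that is a small power of the length. -/
theorem abs_selbergWeights_le {Z d : ℕ} (hZ : 1 ≤ Z) (hd : d ∣ s.prodPrimes) :
    |s.selbergWeights Z d| ≤ (s.nu d)⁻¹ := by
  have hS := selbergSum_pos (s := s) hZ
  have hnu := nu_pos_of_dvd_prodPrimes hd
  have h0 : ∀ l ∈ s.prodPrimes.divisors, 0 ≤ s.selbergTerms l := fun l hl =>
    (selbergTerms_pos (Nat.dvd_of_mem_divisors hl)).le
  have h1 : (∑ l ∈ s.prodPrimes.divisors, if d ∣ l ∧ l ≤ Z then s.selbergTerms l else 0)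
      ≤ s.selbergSum Z := by
    refine sum_le_sum fun l hl => ?_
    have := h0 l hl
    by_cases h1 : d ∣ l <;> by_cases h2 : l ≤ Z <;> simp [h1, h2, this]
  have h2 : 0 ≤ ∑ l ∈ s.prodPrimes.divisors, if d ∣ l ∧ l ≤ Z then s.selbergTerms l else 0 :=
    sum_nonneg fun l hl => by split_ifs; exacts [h0 l hl, le_rfl]
  have hmu : |(μ d : ℝ)| ≤ 1 := by exact_mod_cast abs_moebius_le_one
  rw [selbergWeights, abs_div, abs_mul, abs_mul, abs_of_pos hS, abs_of_pos (inv_pos.2 hnu),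
    abs_of_nonneg h2, div_le_iff₀ hS]
  gcongr
  calc _ ≤ 1 * s.selbergSum Z := by gcongr
    _ = _ := one_mul _

/-- With `e = l * f` squarefree and `d = l * c`, `μ` factors and what remains is the sum of `μ` over
the divisors of `f`. -/
theorem sum_moebius_between {l e P : ℕ} (hP : Squarefree P) (he : e ∣ P) :
    (∑ d ∈ P.divisors, if l ∣ d ∧ d ∣ e then (μ d : ℝ) else 0) =
      if l = e then (μ l : ℝ) else 0 := by
  by_cases hle : l ∣ e
  · obtain ⟨f, rfl⟩ := hle
    have hsq := hP.squarefree_of_dvd he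
    have hl0 : l ≠ 0 := by rintro rfl; simp at hsq
    have hf0 : f ≠ 0 := by rintro rfl; simp at hsq
    have hfil : {d ∈ P.divisors | l ∣ d ∧ d ∣ l * f} = f.divisors.image (l * ·) := by
      ext d
      simp only [mem_filter, Nat.mem_divisors, mem_image]
      constructor
      · rintro ⟨-, ⟨c, rfl⟩, h⟩
        exact ⟨c, ⟨Nat.dvd_of_mul_dvd_mul_left (Nat.pos_of_ne_zero hl0) h, hf0⟩, rfl⟩
      · rintro ⟨c, ⟨h, -⟩, rfl⟩
        have := Nat.mul_dvd_mul_left l h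
        exact ⟨⟨this.trans he, hP.ne_zero⟩, dvd_mul_right _ _, this⟩
    rw [← sum_filter, hfil, sum_image (by
      intro a _ b _ h; exact Nat.eq_of_mul_eq_mul_left (Nat.pos_of_ne_zero hl0) h)]
    have hcop : l.Coprime f := (Nat.squarefree_mul_iff.1 hsq).1
    have : ∀ c ∈ f.divisors, (μ (l * c) : ℝ) = μ l * μ c := by
      intro c hc
      rw [isMultiplicative_moebius.map_mul_of_coprime
        (hcop.coprime_dvd_right (Nat.dvd_of_mem_divisors hc))]
      push_cast; rfl
    rw [sum_congr rfl this, ← mul_sum]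
    have hm : (∑ c ∈ f.divisors, (μ c : ℝ)) = if f = 1 then 1 else 0 := by
      have h := congrArg (fun g : ArithmeticFunction ℤ => g f) moebius_mul_coe_zeta
      rw [coe_mul_zeta_apply, one_apply] at h
      exact_mod_cast h
    rw [hm]
    by_cases hf : f = 1
    · simp [hf]
    · have : l ≠ l * f := by
        intro h
        exact hf (Nat.eq_of_mul_eq_mul_left (Nat.pos_of_ne_zero hl0) (by omega))
      simp [hf, this]
  · rw [sum_eq_zero, if_neg]
    · rintro rfl; exact hle dvd_rfl
    · intro d _
      rw [if_neg]
      rintro ⟨h1, h2⟩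
      exact hle (h1.trans h2)

/-- Möbius inversion: these are the variables in which the quadratic form of the main sum is
diagonal. -/
theorem sum_nu_mul_selbergWeights {Z l : ℕ} (hl : l ∣ s.prodPrimes) :
    (∑ d ∈ s.prodPrimes.divisors, if l ∣ d then s.nu d * s.selbergWeights Z d else 0) =
      if l ≤ Z then (μ l : ℝ) * s.selbergTerms l / s.selbergSum Z else 0 := by
  have h1 : ∀ d ∈ s.prodPrimes.divisors, (if l ∣ d then s.nu d * s.selbergWeights Z d else 0) =
      ∑ e ∈ s.prodPrimes.divisors, (if e ≤ Z then s.selbergTerms e / s.selbergSum Z else 0) *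
        (if l ∣ d ∧ d ∣ e then (μ d : ℝ) else 0) := by
    intro d hd
    have hnu := nu_ne_zero (Nat.dvd_of_mem_divisors hd)
    split_ifs with h
    · rw [selbergWeights, mul_div_assoc, mul_inv_cancel_left₀ hnu, mul_sum, sum_div]
      refine sum_congr rfl fun e _ => ?_
      by_cases h1 : d ∣ e <;> by_cases h2 : e ≤ Z <;> simp [h, h1, h2]
      ring
    · simp [h]
  rw [sum_congr rfl h1, sum_comm]
  have h2 : ∀ e ∈ s.prodPrimes.divisors,
      (∑ d ∈ s.prodPrimes.divisors, (if e ≤ Z then s.selbergTerms e / s.selbergSum Z else 0) *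
        (if l ∣ d ∧ d ∣ e then (μ d : ℝ) else 0)) =
      if l = e then (if l ≤ Z then (μ l : ℝ) * s.selbergTerms l / s.selbergSum Z else 0)
        else 0 := by
    intro e he
    rw [← mul_sum, sum_moebius_between s.prodPrimes_squarefree (Nat.dvd_of_mem_divisors he)]
    by_cases h : l = e
    · subst h
      by_cases h2 : l ≤ Z <;> simp [h2]
      ring
    · simp [h]
  rw [sum_congr rfl h2, sum_ite_eq, if_pos (Nat.mem_divisors.2 ⟨hl, prodPrimes_ne_zero⟩)]

theorem mainSum_selbergWeights {Z : ℕ} (hZ : 1 ≤ Z) :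
    s.mainSum (lambdaSquared (s.selbergWeights Z)) = (s.selbergSum Z)⁻¹ := by
  have hS := (selbergSum_pos (s := s) hZ).ne'
  rw [mainSum_lambdaSquared_eq_sum_mul_sum_sq]
  have : ∀ l ∈ s.prodPrimes.divisors, (s.selbergTerms l)⁻¹ *
      (∑ d ∈ s.prodPrimes.divisors, if l ∣ d then s.nu d * s.selbergWeights Z d else 0) ^ 2 =
      (if l ≤ Z then s.selbergTerms l else 0) / (s.selbergSum Z) ^ 2 := by
    intro l hl
    have hlP := Nat.dvd_of_mem_divisors hl
    have hg := (selbergTerms_pos hlP).ne'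
    rw [sum_nu_mul_selbergWeights hlP]
    split_ifs
    · have hmu : (μ l : ℝ) ^ 2 = 1 := by
        exact_mod_cast moebius_sq_eq_one_of_squarefree (squarefree_of_dvd_prodPrimes hlP)
      rw [div_pow, mul_pow, hmu]
      field_simp
    · simp
  rw [sum_congr rfl this, ← sum_div]
  change s.selbergSum Z / _ = _
  field_simp

/-- Each pair `(d1, d2)` feeds only the modulus `lcm d1 d2`, so the triple sum collapses to a
square. -/
theorem errSum_lambdaSquared_le (w : ℕ → ℝ) (hrem : ∀ d, d ∣ s.prodPrimes → |s.rem d| ≤ 1) :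
    s.errSum (lambdaSquared w) ≤ (∑ d ∈ s.prodPrimes.divisors, |w d|) ^ 2 := by
  have hP : s.prodPrimes ≠ 0 := prodPrimes_ne_zero
  calc s.errSum (lambdaSquared w)
      ≤ ∑ d ∈ s.prodPrimes.divisors, ∑ d1 ∈ s.prodPrimes.divisors, ∑ d2 ∈ s.prodPrimes.divisors,
        if d = Nat.lcm d1 d2 then |w d1| * |w d2| else 0 := by
        refine sum_le_sum fun d hd => ?_
        have hsub := Nat.divisors_subset_of_dvd hP (Nat.dvd_of_mem_divisors hd)
        have hnn : ∀ d1 d2 : ℕ, 0 ≤ if d = Nat.lcm d1 d2 then |w d1| * |w d2| else 0 :=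
          fun d1 d2 => by positivity
        calc |lambdaSquared w d| * |s.rem d| ≤ |lambdaSquared w d| * 1 := by
              gcongr; exact hrem d (Nat.dvd_of_mem_divisors hd)
          _ ≤ ∑ d1 ∈ d.divisors, ∑ d2 ∈ d.divisors,
              if d = Nat.lcm d1 d2 then |w d1| * |w d2| else 0 := by
              rw [mul_one, lambdaSquared]
              refine (abs_sum_le_sum_abs _ _).trans (sum_le_sum fun d1 _ => ?_)
              refine (abs_sum_le_sum_abs _ _).trans (sum_le_sum fun d2 _ => ?_)
              split_ifs <;> simp [abs_mul]
          _ ≤ ∑ d1 ∈ d.divisors, ∑ d2 ∈ s.prodPrimes.divisors,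
              if d = Nat.lcm d1 d2 then |w d1| * |w d2| else 0 :=
              sum_le_sum fun d1 _ => sum_le_sum_of_subset_of_nonneg hsub fun _ _ _ => hnn _ _
          _ ≤ _ := sum_le_sum_of_subset_of_nonneg hsub fun _ _ _ =>
              sum_nonneg fun _ _ => hnn _ _
    _ = ∑ d1 ∈ s.prodPrimes.divisors, ∑ d2 ∈ s.prodPrimes.divisors, |w d1| * |w d2| := by
        rw [sum_comm]
        refine sum_congr rfl fun d1 hd1 => ?_
        rw [sum_comm]
        refine sum_congr rfl fun d2 hd2 => ?_
        rw [sum_ite_eq_of_mem']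
        exact Nat.mem_divisors.2 ⟨Nat.lcm_dvd (Nat.dvd_of_mem_divisors hd1)
          (Nat.dvd_of_mem_divisors hd2), hP⟩
    _ = _ := by rw [sq, sum_mul_sum]

/-- The Selberg upper bound sieve for a sequence whose remainders are at most `1`. -/
theorem siftedSum_le_selberg {Z : ℕ} (hZ : 1 ≤ Z)
    (hrem : ∀ d, d ∣ s.prodPrimes → |s.rem d| ≤ 1) :
    s.siftedSum ≤ s.totalMass / s.selbergSum Z +
      (∑ d ∈ s.prodPrimes.divisors, if d ≤ Z then (s.nu d)⁻¹ else 0) ^ 2 := by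
  have h := siftedSum_le_mainSum_errSum_of_upperMoebius (s := s) _
    (upperMoebius_lambdaSquared (s.selbergWeights Z) (selbergWeights_one hZ))
  rw [mainSum_selbergWeights hZ, ← div_eq_mul_inv] at h
  refine h.trans (add_le_add_right ((errSum_lambdaSquared_le _ hrem).trans ?_) _)
  gcongr with d hd
  split_ifs with hdZ
  · exact abs_selbergWeights_le hZ (Nat.dvd_of_mem_divisors hd)
  · rw [selbergWeights_eq_zero (not_le.1 hdZ), abs_zero]

end BoundingSieve


/-! ### Sieving the values `m * k + 1` -/

/-- The number of `k ≤ N` with `m * k + 1` divisible by `d` is `N / d + O(1)`. -/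
theorem abs_card_dvd_mul_add_one_sub_le {m d : ℕ} (hd : 0 < d) (hmd : m.Coprime d) (N : ℕ) :
    |(#{k ∈ Icc 1 N | d ∣ m * k + 1} : ℝ) - (d : ℝ)⁻¹ * N| ≤ 1 := by
  have : NeZero d := ⟨hd.ne'⟩
  set r : ℕ := (-(m : ZMod d)⁻¹).val
  have hr : ((r : ℕ) : ZMod d) = -(m : ZMod d)⁻¹ := ZMod.natCast_zmod_val _
  have hinv : (m : ZMod d) * (m : ZMod d)⁻¹ = 1 := ZMod.coe_mul_inv_eq_one m hmd
  have hiff : ∀ k : ℕ, d ∣ m * k + 1 ↔ k ≡ r [MOD d] := by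
    intro k
    rw [← ZMod.natCast_eq_natCast_iff, ← ZMod.natCast_eq_zero_iff, hr]
    push_cast
    constructor
    · intro h
      linear_combination (m : ZMod d)⁻¹ * h - (k : ZMod d) * hinv
    · intro h
      linear_combination (m : ZMod d) * h - hinv
  have hset : {k ∈ Icc 1 N | d ∣ m * k + 1} = {k ∈ Ioc 0 N | k ≡ r [MOD d]} := by
    ext k; simp [hiff, Nat.succ_le_iff]
  have hcard := Nat.Ioc_filter_modEq_card 0 N hd r
  rw [hset]
  have hdR : (0 : ℚ) < d := by exact_mod_cast hd
  have key : |(#{k ∈ Ioc 0 N | k ≡ r [MOD d]} : ℚ) - (d : ℚ)⁻¹ * N| ≤ 1 := by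
    have h1 : ((#{k ∈ Ioc 0 N | k ≡ r [MOD d]} : ℤ) : ℚ) = _ := congrArg (Int.cast : ℤ → ℚ) hcard
    -- Monotonicity of the floor removes the truncation at `0` in the counting formula.
    have hmono : ⌊(((0 : ℕ) : ℚ) - r) / d⌋ ≤ ⌊((N : ℚ) - r) / d⌋ := by
      apply Int.floor_le_floor
      gcongr
      simp
    rw [max_eq_left (by linarith)] at h1
    push_cast at h1 hmono
    rw [h1]
    have a1 := Int.floor_le (((N : ℚ) - r) / d)
    have a2 := Int.lt_floor_add_one (((N : ℚ) - r) / d)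
    have a3 := Int.floor_le (((0 : ℚ) - r) / d)
    have a4 := Int.lt_floor_add_one (((0 : ℚ) - r) / d)
    have e : (d : ℚ)⁻¹ * N = ((N : ℚ) - r) / d - ((0 : ℚ) - r) / d := by ring
    rw [abs_le, e]
    constructor <;> linarith
  have key' := (Rat.cast_le (K := ℝ)).2 key
  push_cast at key'
  exact key'

/-- The product of the primes up to `Z` that do not divide `m`. -/
def coprimePrimorial (m Z : ℕ) : ℕ := ∏ p ∈ Icc 1 Z with p.Prime ∧ ¬ p ∣ m, p

theorem coprimePrimorial_ne_zero (m Z : ℕ) : coprimePrimorial m Z ≠ 0 :=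
  prod_ne_zero_iff.2 fun _ hp => (mem_filter.1 hp).2.1.ne_zero

theorem squarefree_coprimePrimorial (m Z : ℕ) : Squarefree (coprimePrimorial m Z) := by
  unfold coprimePrimorial
  refine (Finset.squarefree_prod_of_pairwise_isCoprime ?_ ?_)
  · intro p hp q hq hpq
    exact Nat.coprime_iff_isRelPrime.1
      ((Nat.coprime_primes (mem_filter.1 hp).2.1 (mem_filter.1 hq).2.1).2 hpq)
  · intro p hp
    exact (mem_filter.1 hp).2.1.prime.squarefree

theorem prime_dvd_coprimePrimorial {m Z p : ℕ} (hp : p.Prime) :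
    p ∣ coprimePrimorial m Z ↔ p ≤ Z ∧ ¬ p ∣ m := by
  constructor
  · intro h
    obtain ⟨q, hq, hpq⟩ := (hp.prime.dvd_finsetProd_iff _).1 h
    obtain ⟨h1, h2, h3⟩ := mem_filter.1 hq
    rw [(Nat.prime_dvd_prime_iff_eq hp h2).1 hpq]
    exact ⟨(mem_Icc.1 h1).2, h3⟩
  · rintro ⟨h1, h2⟩
    exact dvd_prod_of_mem _ (mem_filter.2 ⟨mem_Icc.2 ⟨hp.one_le, h1⟩, hp, h2⟩)

/-- The sieve of the numbers `m * k + 1`, `k ≤ N`, by the primes up to `Z` not dividing `m`. -/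
noncomputable def progressionSieve (m N Z : ℕ) : BoundingSieve where
  support := (Icc 1 N).image fun k => m * k + 1
  prodPrimes := coprimePrimorial m Z
  prodPrimes_squarefree := squarefree_coprimePrimorial m Z
  weights := fun _ => 1
  weights_nonneg := fun _ => zero_le_one
  totalMass := N
  nu := ⟨fun n => (n : ℝ)⁻¹, by simp⟩
  nu_mult := ⟨by simp, fun _ => by simp [mul_comm]⟩
  nu_pos_of_prime := fun p hp _ => by
    simpa using hp.pos
  nu_lt_one_of_prime := fun p hp _ => by
    simpa using inv_lt_one_of_one_lt₀ (by exact_mod_cast hp.one_lt : (1 : ℝ) < p)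

theorem progressionSieve_nu (m N Z n : ℕ) : (progressionSieve m N Z).nu n = (n : ℝ)⁻¹ := rfl

theorem abs_rem_progressionSieve_le {m N Z d : ℕ} (hm : 0 < m)
    (hd : d ∣ (progressionSieve m N Z).prodPrimes) :
    |(progressionSieve m N Z).rem d| ≤ 1 := by
  have hd0 : 0 < d := Nat.pos_of_ne_zero
    (ne_zero_of_dvd_ne_zero (coprimePrimorial_ne_zero m Z) hd)
  have hcop : m.Coprime d := Nat.Coprime.symm <| Nat.coprime_of_dvd fun p hp hpd hpm =>
    ((prime_dvd_coprimePrimorial hp).1 (hpd.trans hd)).2 hpm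
  have h := abs_card_dvd_mul_add_one_sub_le hd0 hcop N
  have hms : (progressionSieve m N Z).multSum d = #{k ∈ Icc 1 N | d ∣ m * k + 1} := by
    simp only [BoundingSieve.multSum, progressionSieve]
    rw [sum_image fun a _ b _ hab => Nat.eq_of_mul_eq_mul_left hm (by simpa using hab)]
    simp
  rw [BoundingSieve.rem, hms]
  exact h

/-- A prime `m * k + 1` with `k > Z` exceeds `Z`, hence survives the sieve; the `k ≤ Z` are counted
trivially. -/
theorem card_prime_le_siftedSum {m N Z : ℕ} (hm : 0 < m) :
    (#{k ∈ Icc 1 N | (m * k + 1).Prime} : ℝ) ≤ Z + (progressionSieve m N Z).siftedSum := by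
  have hs : (progressionSieve m N Z).siftedSum =
      #{k ∈ Icc 1 N | (coprimePrimorial m Z).Coprime (m * k + 1)} := by
    have h : (progressionSieve m N Z).siftedSum = ∑ n ∈ (Icc 1 N).image fun k => m * k + 1,
        if (coprimePrimorial m Z).Coprime n then (1 : ℝ) else 0 := rfl
    rw [h, sum_image fun a _ b _ hab => Nat.eq_of_mul_eq_mul_left hm (by simpa using hab)]
    simp
  rw [hs]
  have hsub : {k ∈ Icc 1 N | (m * k + 1).Prime} ⊆
      Icc 1 Z ∪ {k ∈ Icc 1 N | (coprimePrimorial m Z).Coprime (m * k + 1)} := by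
    intro k hk
    obtain ⟨h1, h2⟩ := mem_filter.1 hk
    rw [mem_union, mem_filter, mem_Icc]
    by_cases hkZ : k ≤ Z
    · exact Or.inl ⟨(mem_Icc.1 h1).1, hkZ⟩
    · refine Or.inr ⟨h1, Nat.Coprime.symm ?_⟩
      rw [h2.coprime_iff_not_dvd, prime_dvd_coprimePrimorial h2]
      rintro ⟨h3, -⟩
      have := Nat.le_mul_of_pos_left k hm
      omega
  have := (card_le_card hsub).trans (card_union_le _ _)
  rw [Nat.card_Icc, Nat.add_sub_cancel] at this
  exact_mod_cast this

/-! ### Lower bound for the Selberg sum, and the Brun–Titchmarsh bound -/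

theorem hasSum_inv_factoredNumbers (s : Finset ℕ) (hs : ∀ p ∈ s, p.Prime) :
    HasSum (fun n : Nat.factoredNumbers s => ((n : ℕ) : ℝ)⁻¹) (∏ p ∈ s, (1 - (p : ℝ)⁻¹)⁻¹) := by
  let f : ℕ →* ℝ :=
    { toFun := fun n => (n : ℝ)⁻¹
      map_one' := by simp
      map_mul' := fun a b => by simp [mul_comm] }
  have h := (EulerProduct.summable_and_hasSum_factoredNumbers_prod_filter_prime_geometric
    (f := f) (fun {p} hp => by
      change ‖((p : ℝ)⁻¹)‖ < 1
      rw [norm_inv, RCLike.norm_natCast]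
      exact inv_lt_one_of_one_lt₀ (by exact_mod_cast hp.one_lt)) s).2
  rw [filter_true_of_mem hs] at h
  exact h

theorem sum_inv_le_prod_of_forall_mem_factoredNumbers {s : Finset ℕ} (hs : ∀ p ∈ s, p.Prime)
    {A : Finset ℕ} (hA : ∀ n ∈ A, n ∈ Nat.factoredNumbers s) :
    ∑ n ∈ A, (n : ℝ)⁻¹ ≤ ∏ p ∈ s, (1 - (p : ℝ)⁻¹)⁻¹ := by
  have h := hasSum_inv_factoredNumbers s hs
  replace h := (hasSum_subtype_iff_indicator (f := fun n : ℕ => (n : ℝ)⁻¹)).1 h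
  refine le_trans (le_of_eq ?_) (sum_le_hasSum A (fun n _ => ?_) h)
  · exact sum_congr rfl fun n hn => (Set.indicator_of_mem (hA n hn) (fun n : ℕ => (n : ℝ)⁻¹)).symm
  · exact Set.indicator_nonneg (fun _ _ => by positivity) _

theorem prod_primeFactors_one_sub_inv {m : ℕ} (hm : 0 < m) :
    ∏ p ∈ m.primeFactors, (1 - (p : ℝ)⁻¹)⁻¹ = m / m.totient := by
  have h := Nat.totient_eq_mul_prod_factors m
  have h2 : (m.totient : ℝ) = m * ∏ p ∈ m.primeFactors, (1 - (p : ℝ)⁻¹) := by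
    have h' := congrArg (Rat.cast : ℚ → ℝ) h
    push_cast at h'
    exact h'
  have hm' : (m : ℝ) ≠ 0 := by exact_mod_cast hm.ne'
  rw [prod_inv_distrib, h2, div_mul_cancel_left₀ hm']

/-- Group the `n ≤ Z` by `d`, the product of the primes dividing `n` but not `m`. Then `n / d` has
only primes of `d` or `m`, so by the Euler product the group contributes at most `selbergTerms d`
times `m / φ(m)`. -/
theorem harmonic_le_selbergSum {m N Z : ℕ} (hm : 0 < m) :
    ∑ n ∈ Icc 1 Z, (n : ℝ)⁻¹ ≤
      (m / m.totient : ℝ) * (progressionSieve m N Z).selbergSum Z := by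
  let l : ℕ → ℕ := fun n => ∏ p ∈ n.primeFactors \ m.primeFactors, p
  have hlpf : ∀ n, (l n).primeFactors = n.primeFactors \ m.primeFactors := fun n =>
    Nat.primeFactors_prod fun p hp => Nat.prime_of_mem_primeFactors (mem_sdiff.1 hp).1
  have hln : ∀ n, l n ∣ n := fun n =>
    (prod_dvd_prod_of_subset _ _ _ sdiff_subset).trans (Nat.prod_primeFactors_dvd n)
  have hlP : ∀ n ∈ Icc 1 Z, l n ∈ {l ∈ (coprimePrimorial m Z).divisors | l ≤ Z} := by
    intro n hn
    obtain ⟨h1, h2⟩ := mem_Icc.1 hn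
    refine mem_filter.2 ⟨Nat.mem_divisors.2 ⟨?_, coprimePrimorial_ne_zero m Z⟩,
      (Nat.le_of_dvd h1 (hln n)).trans h2⟩
    refine prod_dvd_prod_of_subset _ _ _ fun p hp => ?_
    obtain ⟨h3, h4⟩ := mem_sdiff.1 hp
    have hpp := Nat.prime_of_mem_primeFactors h3
    refine mem_filter.2 ⟨mem_Icc.2 ⟨hpp.one_le, (Nat.le_of_mem_primeFactors h3).trans h2⟩, hpp, ?_⟩
    exact fun h => h4 (Nat.mem_primeFactors.2 ⟨hpp, h, hm.ne'⟩)
  rw [← sum_fiberwise_of_maps_to hlP, BoundingSieve.selbergSum, ← sum_filter, mul_sum]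
  refine sum_le_sum fun d hd => ?_
  obtain ⟨hd, hdZ⟩ := mem_filter.1 hd
  have hdP := Nat.dvd_of_mem_divisors hd
  have hd0 : 0 < d := Nat.pos_of_mem_divisors hd
  have hdR : (0 : ℝ) < d := by exact_mod_cast hd0
  have hdisj : Disjoint d.primeFactors m.primeFactors := by
    rw [disjoint_left]
    intro p hp hpm
    exact ((prime_dvd_coprimePrimorial (Nat.prime_of_mem_primeFactors hp)).1
      ((Nat.dvd_of_mem_primeFactors hp).trans hdP)).2 (Nat.dvd_of_mem_primeFactors hpm)
  have hfac : ∀ n ∈ {n ∈ Icc 1 Z | l n = d}.image (· / d),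
      n ∈ Nat.factoredNumbers (d.primeFactors ∪ m.primeFactors) := by
    intro b hb
    obtain ⟨n, hn, rfl⟩ := mem_image.1 hb
    obtain ⟨hn, hnl⟩ := mem_filter.1 hn
    have hn0 : 0 < n := (mem_Icc.1 hn).1
    have hdn : d ∣ n := hnl ▸ hln n
    have hb0 : n / d ≠ 0 := (Nat.div_pos (Nat.le_of_dvd hn0 hdn) hd0).ne'
    refine Nat.mem_factoredNumbers_of_primeFactors_subset hb0 fun p hp => ?_
    have hpn : p ∈ n.primeFactors :=
      Nat.primeFactors_mono (Nat.div_dvd_of_dvd hdn) hn0.ne' hp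
    rw [mem_union, ← hnl, hlpf, mem_sdiff]
    tauto
  have hpr : ∀ p ∈ d.primeFactors ∪ m.primeFactors, p.Prime := fun p hp => by
    rcases mem_union.1 hp with h | h <;> exact Nat.prime_of_mem_primeFactors h
  have key := sum_inv_le_prod_of_forall_mem_factoredNumbers hpr hfac
  rw [prod_union hdisj, prod_primeFactors_one_sub_inv hm] at key
  have hinj : Set.InjOn (· / d) ({n ∈ Icc 1 Z | l n = d} : Finset ℕ) := by
    intro a ha b hb hab
    have h1 : d ∣ a := (mem_filter.1 ha).2 ▸ hln a
    have h2 : d ∣ b := (mem_filter.1 hb).2 ▸ hln b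
    exact (Nat.div_left_inj h1 h2).1 hab
  rw [sum_image hinj] at key
  have hsum : ∑ n ∈ Icc 1 Z with l n = d, (n : ℝ)⁻¹ =
      (d : ℝ)⁻¹ * ∑ n ∈ Icc 1 Z with l n = d, ((n / d : ℕ) : ℝ)⁻¹ := by
    rw [mul_sum]
    refine sum_congr rfl fun n hn => ?_
    have h1 : d ∣ n := (mem_filter.1 hn).2 ▸ hln n
    rw [Nat.cast_div h1 hdR.ne', inv_div]
    field_simp
  rw [hsum, BoundingSieve.selbergTerms_apply]
  simp only [progressionSieve_nu]
  calc _ ≤ (d : ℝ)⁻¹ * ((∏ p ∈ d.primeFactors, (1 - (p : ℝ)⁻¹)⁻¹) * (m / m.totient)) := by gcongr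
    _ = _ := by ring

/-- A Brun–Titchmarsh type bound for the primes `m * k + 1`, uniform in `m`. -/
theorem card_prime_mul_add_one_le {m : ℕ} (hm : 0 < m) {y : ℝ} (hy : 1 < y) :
    (#{k ∈ Icc 1 ⌊y⌋₊ | (m * k + 1).Prime} : ℝ) ≤
      12 * (m / m.totient) * (y / Real.log y) := by
  have hy0 : 0 < y := by linarith
  -- With exponent `1/8` the sieve error is at most `Z ^ 4 ≤ √y ≤ 2 y / log y`. The final `12` is
  -- `8` from the main term, `2` from this error and `2` from the `Z` trivially counted `k`.
  set Z : ℕ := ⌊y ^ (1 / 8 : ℝ)⌋₊ with hZdef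
  have hy8 : (1 : ℝ) ≤ y ^ (1 / 8 : ℝ) := Real.one_le_rpow hy.le (by norm_num)
  have hZ : 1 ≤ Z := Nat.le_floor (by simpa using hy8)
  have hZle : (Z : ℝ) ≤ y ^ (1 / 8 : ℝ) := Nat.floor_le (by positivity)
  have hlog : 0 < Real.log y := Real.log_pos hy
  have hZlog : Real.log y / 8 ≤ Real.log (Z + 1) := by
    have h : y ^ (1 / 8 : ℝ) ≤ (Z : ℝ) + 1 := (Nat.lt_floor_add_one _).le
    have := Real.log_le_log (by positivity) h
    rw [Real.log_rpow hy0] at this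
    linarith
  have hharm : Real.log (Z + 1) ≤ ∑ n ∈ Icc 1 Z, (n : ℝ)⁻¹ := by
    have := log_add_one_le_harmonic Z
    rw [harmonic_eq_sum_Icc] at this
    push_cast at this
    exact this
  set N := ⌊y⌋₊
  have hN : (N : ℝ) ≤ y := Nat.floor_le hy0.le
  have hS := harmonic_le_selbergSum (N := N) (Z := Z) hm
  have hSpos := BoundingSieve.selbergSum_pos (s := progressionSieve m N Z) hZ
  have htot : (0 : ℝ) < m.totient := by exact_mod_cast Nat.totient_pos.2 hm
  have hmR : (0 : ℝ) < m := by exact_mod_cast hm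
  have hratio : (1 : ℝ) ≤ m / m.totient := by
    rw [one_le_div htot]; exact_mod_cast Nat.totient_le m
  have hmain : (N : ℝ) / (progressionSieve m N Z).selbergSum Z ≤
      8 * (m / m.totient) * (y / Real.log y) := by
    rw [div_le_iff₀ hSpos]
    have h1 : Real.log y / 8 ≤ (m / m.totient : ℝ) * (progressionSieve m N Z).selbergSum Z := by
      linarith
    calc (N : ℝ) ≤ 8 * (y / Real.log y) * (Real.log y / 8) := by field_simp; linarith
      _ ≤ 8 * (y / Real.log y) * ((m / m.totient : ℝ) * (progressionSieve m N Z).selbergSum Z) := by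
        gcongr
      _ = _ := by ring
  have hsift := BoundingSieve.siftedSum_le_selberg (s := progressionSieve m N Z) hZ
    fun d hd => abs_rem_progressionSieve_le hm hd
  have herr : (∑ d ∈ (progressionSieve m N Z).prodPrimes.divisors,
      if d ≤ Z then ((progressionSieve m N Z).nu d)⁻¹ else 0) ≤ (Z : ℝ) ^ 2 := by
    rw [← sum_filter]
    calc _ ≤ ∑ d ∈ Icc 1 Z, (Z : ℝ) := by
          refine sum_le_sum_of_subset_of_nonneg (fun d hd => ?_) (fun _ _ _ => by positivity) |>.trans'
            (sum_le_sum (g := fun _ => (Z : ℝ)) fun d hd => ?_)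
          · obtain ⟨h1, h2⟩ := mem_filter.1 hd
            exact mem_Icc.2 ⟨Nat.pos_of_mem_divisors h1, h2⟩
          · rw [progressionSieve_nu, inv_inv]
            exact_mod_cast (mem_filter.1 hd).2
      _ = (Z : ℝ) ^ 2 := by simp [sq]
  have herr0 : (0 : ℝ) ≤ ∑ d ∈ (progressionSieve m N Z).prodPrimes.divisors,
      if d ≤ Z then ((progressionSieve m N Z).nu d)⁻¹ else 0 := by
    refine sum_nonneg fun d _ => ?_
    rw [progressionSieve_nu, inv_inv]
    positivity
  have hZ4 : (Z : ℝ) ^ 4 ≤ √y := by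
    calc (Z : ℝ) ^ 4 ≤ (y ^ (1 / 8 : ℝ)) ^ 4 := by gcongr
      _ = √y := by
        rw [Real.sqrt_eq_rpow, ← Real.rpow_natCast, ← Real.rpow_mul hy0.le]; norm_num
  have hZR : (1 : ℝ) ≤ Z := by exact_mod_cast hZ
  have hZ1 : (Z : ℝ) ≤ (Z : ℝ) ^ 4 := le_self_pow₀ hZR (by norm_num)
  have hsq : √y ≤ 2 * (y / Real.log y) := by
    have h1 : Real.log y ≤ 2 * √y := by
      have h2 := Real.log_le_sub_one_of_pos (Real.sqrt_pos.2 hy0)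
      rw [Real.log_sqrt hy0.le] at h2
      linarith
    rw [← mul_div_assoc, le_div_iff₀ hlog]
    calc √y * Real.log y ≤ √y * (2 * √y) := by gcongr
      _ = 2 * y := by nlinarith [Real.mul_self_sqrt hy0.le]
  have hq : 0 < y / Real.log y := by positivity
  have hcnt := card_prime_le_siftedSum (N := N) (Z := Z) hm
  have herr2 := pow_le_pow_left₀ herr0 herr 2
  have htm : (progressionSieve m N Z).totalMass = N := rfl
  rw [htm] at hsift
  have h4 : 4 * (y / Real.log y) ≤ 4 * (m / m.totient) * (y / Real.log y) := by
    have := mul_le_mul_of_nonneg_right hratio hq.le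
    linarith
  have : ((Z : ℝ) ^ 2) ^ 2 = (Z : ℝ) ^ 4 := by ring
  linarith


/-! ### The sum of `1 / φ(k)` -/

/-- The product telescopes, since `1 - 1 / n² = (n - 1)(n + 1) / n²`. -/
theorem half_le_prod_one_sub_inv_sq (K : ℕ) :
    (1 / 2 : ℝ) ≤ ∏ n ∈ Icc 2 K, (1 - ((n : ℝ) ^ 2)⁻¹) := by
  have h : ∀ K : ℕ, ∏ n ∈ Icc 2 (K + 1), (1 - ((n : ℝ) ^ 2)⁻¹) = (K + 2) / (2 * (K + 1)) := by
    intro K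
    induction K with
    | zero => simp
    | succ K ih =>
      rw [prod_Icc_succ_top (by omega), ih]
      push_cast
      field_simp
      ring
  rcases K with _ | K
  · norm_num
  · rw [h, div_le_div_iff₀ (by norm_num) (by positivity)]
    linarith

theorem prod_one_add_inv_le_sum_divisors {k : ℕ} (hk : 0 < k) :
    ∏ p ∈ k.primeFactors, (1 + (p : ℝ)⁻¹) ≤ ∑ d ∈ k.divisors, (d : ℝ)⁻¹ := by
  rw [prod_one_add]
  have h : ∀ t ∈ k.primeFactors.powerset, ∏ p ∈ t, (p : ℝ)⁻¹ = ((∏ p ∈ t, p : ℕ) : ℝ)⁻¹ :=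
    fun t _ => by push_cast; rw [prod_inv_distrib]
  have hpr : ∀ t ∈ k.primeFactors.powerset, (∏ p ∈ t, p).primeFactors = t := fun t ht =>
    Nat.primeFactors_prod fun p hp => Nat.prime_of_mem_primeFactors (mem_powerset.1 ht hp)
  rw [sum_congr rfl h, ← sum_image (f := fun d : ℕ => (d : ℝ)⁻¹) (g := fun t => ∏ p ∈ t, p)]
  · refine sum_le_sum_of_subset_of_nonneg (fun d hd => ?_) fun _ _ _ => by positivity
    obtain ⟨t, ht, rfl⟩ := mem_image.1 hd
    exact Nat.mem_divisors.2 ⟨(prod_dvd_prod_of_subset _ _ _ (mem_powerset.1 ht)).trans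
      (Nat.prod_primeFactors_dvd k), hk.ne'⟩
  · intro a ha b hb hab
    rw [← hpr a ha, ← hpr b hb]
    exact congrArg Nat.primeFactors hab

/-- Use `(1 - 1/p)⁻¹ = (1 + 1/p) (1 - 1/p²)⁻¹`: the product of the last factors is at most `2`, and
that of `1 + 1/p` expands over squarefree divisors. -/
theorem div_totient_le_sum_divisors {k : ℕ} (hk : 0 < k) :
    (k / k.totient : ℝ) ≤ 2 * ∑ d ∈ k.divisors, (d : ℝ)⁻¹ := by
  have h1 : (1 / 2 : ℝ) ≤ ∏ p ∈ k.primeFactors, (1 - ((p : ℝ) ^ 2)⁻¹) := by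
    refine (half_le_prod_one_sub_inv_sq k).trans ?_
    refine prod_le_prod_of_subset_of_le_one (fun p hp => mem_Icc.2
      ⟨(Nat.prime_of_mem_primeFactors hp).two_le, Nat.le_of_mem_primeFactors hp⟩)
      (fun n hn => ?_) (fun n _ _ => sub_le_self _ (by positivity))
    have hn2 : (1 : ℝ) ≤ n := by exact_mod_cast one_le_two.trans (mem_Icc.1 hn).1
    exact sub_nonneg.2 (inv_le_one_of_one_le₀ (one_le_pow₀ hn2))
  have h2 : ∀ p ∈ k.primeFactors, (0 : ℝ) < 1 - (p : ℝ)⁻¹ := fun p hp => by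
    rw [sub_pos]
    exact inv_lt_one_of_one_lt₀ (by exact_mod_cast (Nat.prime_of_mem_primeFactors hp).one_lt)
  have h3 : ∏ p ∈ k.primeFactors, (1 - ((p : ℝ) ^ 2)⁻¹) =
      (∏ p ∈ k.primeFactors, (1 - (p : ℝ)⁻¹)) * ∏ p ∈ k.primeFactors, (1 + (p : ℝ)⁻¹) := by
    rw [← prod_mul_distrib]
    exact prod_congr rfl fun p _ => by rw [← inv_pow]; ring
  have h4 := prod_one_add_inv_le_sum_divisors hk
  have h5 : 0 < ∏ p ∈ k.primeFactors, (1 - (p : ℝ)⁻¹) := prod_pos h2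
  rw [← prod_primeFactors_one_sub_inv hk, prod_inv_distrib]
  rw [h3] at h1
  rw [inv_le_iff_one_le_mul₀ h5]
  nlinarith [mul_le_mul_of_nonneg_left h4 h5.le]

theorem sum_inv_sq_le_two (K : ℕ) : ∑ d ∈ Icc 1 K, ((d : ℝ) ^ 2)⁻¹ ≤ 2 := by
  have := sum_Ioo_inv_sq_le (α := ℝ) 0 (K + 1)
  have h : Ioo 0 (K + 1) = Icc 1 K := by ext; simp; omega
  rw [h] at this
  simpa using this

theorem sum_inv_totient_le (K : ℕ) :
    ∑ k ∈ Icc 1 K, (k.totient : ℝ)⁻¹ ≤ 4 * (1 + Real.log K) := by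
  have h1 : ∀ k ∈ Icc 1 K, (k.totient : ℝ)⁻¹ ≤
      ∑ d ∈ Icc 1 K, 2 * if d ∣ k then (d : ℝ)⁻¹ * (k : ℝ)⁻¹ else 0 := by
    intro k hk
    obtain ⟨hk1, hkK⟩ := mem_Icc.1 hk
    have hkR : (0 : ℝ) < k := by exact_mod_cast hk1
    have h := div_totient_le_sum_divisors hk1
    rw [← mul_sum, ← sum_filter]
    have hdiv : k.divisors = {d ∈ Icc 1 K | d ∣ k} := by
      ext d
      simp only [Nat.mem_divisors, mem_filter, mem_Icc]
      constructor
      · rintro ⟨h1, h2⟩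
        exact ⟨⟨Nat.pos_of_dvd_of_pos h1 hk1, (Nat.le_of_dvd hk1 h1).trans hkK⟩, h1⟩
      · rintro ⟨_, h1⟩
        exact ⟨h1, Nat.one_le_iff_ne_zero.1 hk1⟩
    rw [← hdiv, ← sum_mul, ← mul_assoc, ← div_eq_mul_inv, le_div_iff₀ hkR]
    calc _ = (k / k.totient : ℝ) := by ring
      _ ≤ _ := h
  refine (sum_le_sum h1).trans ?_
  -- Putting `k = d * c` separates the sum into `∑ 1 / d² ≤ 2` and a harmonic sum.
  rw [sum_comm]
  have hH : ∑ n ∈ Icc 1 K, (n : ℝ)⁻¹ ≤ 1 + Real.log K := by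
    have := harmonic_le_one_add_log K
    rw [harmonic_eq_sum_Icc] at this
    push_cast at this
    exact this
  have h2 : ∀ d ∈ Icc 1 K, ∑ k ∈ Icc 1 K, 2 * (if d ∣ k then (d : ℝ)⁻¹ * (k : ℝ)⁻¹ else 0) ≤
      2 * ((d : ℝ) ^ 2)⁻¹ * ∑ n ∈ Icc 1 K, (n : ℝ)⁻¹ := by
    intro d hd
    obtain ⟨hd1, _⟩ := mem_Icc.1 hd
    rw [← mul_sum, ← sum_filter, mul_assoc]
    refine mul_le_mul_of_nonneg_left ?_ zero_le_two
    rw [mul_sum]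
    have hsub : {k ∈ Icc 1 K | d ∣ k} ⊆ (Icc 1 K).image (d * ·) := by
      intro k hk
      obtain ⟨hk, c, rfl⟩ := mem_filter.1 hk
      obtain ⟨hk1, hkK⟩ := mem_Icc.1 hk
      refine mem_image.2 ⟨c, mem_Icc.2 ⟨Nat.pos_of_mul_pos_left hk1, ?_⟩, rfl⟩
      exact (Nat.le_mul_of_pos_left c hd1).trans hkK
    refine (sum_le_sum_of_subset_of_nonneg hsub fun _ _ _ => by positivity).trans ?_
    rw [sum_image fun a _ b _ hab => Nat.eq_of_mul_eq_mul_left hd1 hab]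
    refine le_of_eq (sum_congr rfl fun c _ => ?_)
    push_cast
    rw [mul_inv, sq, mul_inv]
    ring
  refine (sum_le_sum h2).trans ?_
  rw [← sum_mul, ← mul_sum]
  have h3 := sum_inv_sq_le_two K
  have h4 : 0 ≤ ∑ n ∈ Icc 1 K, (n : ℝ)⁻¹ := sum_nonneg fun _ _ => by positivity
  calc _ ≤ 2 * 2 * ∑ n ∈ Icc 1 K, (n : ℝ)⁻¹ := by gcongr
    _ ≤ 2 * 2 * (1 + Real.log K) := by gcongr
    _ = _ := by ring


/-! ### The two integrals -/

theorem primesMod_mono (m a : ℕ) : Monotone fun t : ℝ => (primesMod t m a : ℝ) := by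
  intro s t hst
  have : primesMod s m a ≤ primesMod t m a :=
    card_le_card (filter_subset_filter _ (Icc_subset_Icc_right (Nat.floor_le_floor hst)))
  exact Nat.cast_le.2 this

theorem primesMod_eq_zero_of_lt_two {t : ℝ} (ht : t < 2) (m a : ℕ) : primesMod t m a = 0 := by
  refine card_eq_zero.2 (filter_eq_empty_iff.2 fun p hp h => ?_)
  have h1 : ⌊t⌋₊ < 2 := Nat.floor_lt' (by norm_num) |>.2 (by exact_mod_cast ht)
  have := h.1.two_le
  have := (mem_Icc.1 hp).2
  omega

/-- A cutoff `K` independent of `t` makes the count a fixed finite sum of indicators, ready for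
termwise integration. -/
theorem primesMod_one_eq {m : ℕ} (hm : 2 ≤ m) {t : ℝ} (ht : 0 ≤ t) {K : ℕ}
    (hK : ⌊t / m⌋₊ ≤ K) :
    primesMod t m 1 = #{k ∈ {k ∈ Icc 1 K | (m * k + 1).Prime} | ((m * k + 1 : ℕ) : ℝ) ≤ t} := by
  have hm0 : (0 : ℝ) < m := by positivity
  symm
  refine card_bij (fun k _ => m * k + 1) (fun k hk => ?_) (fun a _ b _ hab => ?_) fun p hp => ?_
  · obtain ⟨h1, h2⟩ := mem_filter.1 hk
    refine mem_filter.2 ⟨mem_Icc.2 ⟨by omega, Nat.le_floor h2⟩, (mem_filter.1 h1).2, ?_⟩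
    simp [Nat.ModEq]
  · exact Nat.eq_of_mul_eq_mul_left (by omega : 0 < m) (by simpa using hab)
  · obtain ⟨h1, h2, h3⟩ := mem_filter.1 hp
    have hpt : (p : ℝ) ≤ t := (Nat.le_floor_iff ht).1 (mem_Icc.1 h1).2
    obtain ⟨k, hk⟩ := (Nat.modEq_iff_dvd' h2.one_le).1 h3.symm
    have hpk : p = m * k + 1 := by have := h2.one_le; omega
    subst hpk
    have hk1 : 1 ≤ k := by
      rcases Nat.eq_zero_or_pos k with rfl | h
      · exact absurd h2 (by norm_num)
      · exact h
    refine ⟨k, mem_filter.2 ⟨mem_filter.2 ⟨mem_Icc.2 ⟨hk1, le_trans ?_ hK⟩, h2⟩, hpt⟩, rfl⟩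
    refine Nat.le_floor ?_
    rw [le_div_iff₀ hm0]
    push_cast at hpt
    linarith

theorem intervalIntegrable_primesMod_div (m : ℕ) {a b : ℝ} (ha : 2 ≤ a) (hb : 2 ≤ b) :
    IntervalIntegrable (fun t => (primesMod t m 1 : ℝ) / (t - 1) ^ 2) volume a b := by
  simp_rw [div_eq_mul_inv]
  refine ((primesMod_mono m 1).intervalIntegrable).mul_continuousOn ?_
  refine ContinuousOn.inv₀ (by fun_prop) fun t ht => ?_
  have : 2 ≤ t := (le_inf ha hb).trans ht.1
  exact pow_ne_zero 2 (by linarith)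

/-- This is the first integral at `m = 1`, where the upper limit is `1`, below `2`; it kills the
term `m = 1`. -/
theorem integral_two_one_primesMod :
    ∫ t in (2 : ℝ)..1, (primesMod t 1 1 : ℝ) / (t - 1) ^ 2 = 0 := by
  refine intervalIntegral.integral_zero_ae ?_
  filter_upwards [compl_mem_ae_iff.2 (measure_singleton (2 : ℝ))] with t ht htI
  rw [Set.uIoc_of_ge (by norm_num)] at htI
  have : t < 2 := lt_of_le_of_ne htI.2 ht
  simp [primesMod_eq_zero_of_lt_two this]

theorem integrableOn_and_integral_inv_sub_one_sq {a : ℝ} (ha : 1 < a) :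
    IntegrableOn (fun t : ℝ => ((t - 1) ^ 2)⁻¹) (Set.Ici a) ∧
      ∫ t in Set.Ici a, ((t - 1) ^ 2)⁻¹ = (a - 1)⁻¹ := by
  have hd : ∀ t ∈ Set.Ici a, HasDerivAt (fun t : ℝ => -(t - 1)⁻¹) ((t - 1) ^ 2)⁻¹ t := by
    intro t ht
    have ht' : t - 1 ≠ 0 := by have : a ≤ t := ht; linarith
    have h := (((hasDerivAt_id' t).sub_const 1).fun_inv ht').fun_neg
    rwa [neg_div, neg_neg, one_div] at h
  have hlim : Filter.Tendsto (fun t : ℝ => -(t - 1)⁻¹) Filter.atTop (nhds 0) := by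
    have := (tendsto_inv_atTop_zero.comp
      (Filter.tendsto_atTop_add_const_right Filter.atTop (-1 : ℝ) Filter.tendsto_id)).neg
    simpa [sub_eq_add_neg, Function.comp_def] using this
  have hint := integrableOn_Ioi_deriv_of_nonneg' hd (fun t _ => by positivity) hlim
  refine ⟨(integrableOn_Ici_iff_integrableOn_Ioi).2 hint, ?_⟩
  rw [integral_Ici_eq_integral_Ioi, integral_Ioi_of_hasDerivAt_of_tendsto' hd hint hlim]
  ring

/-- The sum of `1 / (p - 1)` over the primes `p = m * k + 1` with `k ≤ K`. -/
noncomputable def sumInvPrimes (m K : ℕ) : ℝ :=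
  ∑ k ∈ Icc 1 K with (m * k + 1).Prime, ((m : ℝ) * k)⁻¹

theorem sumInvPrimes_nonneg (m K : ℕ) : 0 ≤ sumInvPrimes m K :=
  sum_nonneg fun _ _ => by positivity

/-- Each prime `p = m * k + 1` enters as the indicator of `t ≥ p`, and `(t - 1)⁻²` integrates over
`[p, ∞)` to `1 / (p - 1)`. -/
theorem integral_primesMod_le_sumInvPrimes {m : ℕ} (hm : 2 ≤ m) {T : ℝ} (hT : 2 ≤ T) :
    ∫ t in (2 : ℝ)..T, (primesMod t m 1 : ℝ) / (t - 1) ^ 2 ≤ sumInvPrimes m ⌊T / m⌋₊ := by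
  set K := ⌊T / m⌋₊
  have hm0 : (0 : ℝ) < m := by positivity
  set F := {k ∈ Icc 1 K | (m * k + 1).Prime}
  let g : ℕ → ℝ → ℝ := fun k =>
    (Set.Ici (((m * k + 1 : ℕ) : ℝ))).indicator fun t => ((t - 1) ^ 2)⁻¹
  have hlt : ∀ k ∈ F, (1 : ℝ) < ((m * k + 1 : ℕ) : ℝ) := fun k hk => by
    exact_mod_cast (mem_filter.1 hk).2.one_lt
  have hgint : ∀ k ∈ F, Integrable (g k) := fun k hk =>
    (integrable_indicator_iff measurableSet_Ici).2
      (integrableOn_and_integral_inv_sub_one_sq (hlt k hk)).1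
  have hgI : ∀ k ∈ F, ∫ t, g k t = ((m : ℝ) * k)⁻¹ := fun k hk => by
    rw [integral_indicator measurableSet_Ici,
      (integrableOn_and_integral_inv_sub_one_sq (hlt k hk)).2]
    push_cast
    rw [add_sub_cancel_right]
  have hg0 : ∀ k, 0 ≤ g k := fun k => Set.indicator_nonneg fun _ _ => by positivity
  calc ∫ t in (2 : ℝ)..T, (primesMod t m 1 : ℝ) / (t - 1) ^ 2
      = ∫ t in (2 : ℝ)..T, ∑ k ∈ F, g k t := by
        refine intervalIntegral.integral_congr fun t ht => ?_
        rw [Set.uIcc_of_le hT] at ht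
        have h := primesMod_one_eq hm (by linarith [ht.1] : (0 : ℝ) ≤ t) (K := K)
          (Nat.floor_le_floor (by gcongr; exact ht.2))
        simp only [g, Set.indicator_apply, Set.mem_Ici]
        rw [h, ← sum_filter, sum_const, nsmul_eq_mul, div_eq_mul_inv]
    _ = ∑ k ∈ F, ∫ t in (2 : ℝ)..T, g k t :=
        intervalIntegral.integral_finsetSum fun k hk => (hgint k hk).intervalIntegrable
    _ ≤ ∑ k ∈ F, ∫ t, g k t := by
        refine sum_le_sum fun k hk => ?_
        rw [intervalIntegral.integral_of_le hT]
        exact setIntegral_le_integral (hgint k hk) (Filter.Eventually.of_forall (hg0 k))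
    _ = sumInvPrimes m K := sum_congr rfl hgI

theorem primesMod_div_le {m : ℕ} (hm : 2 ≤ m) {t : ℝ} (ht : (m : ℝ) < t) :
    (primesMod t m 1 : ℝ) / (t - 1) ^ 2 ≤
      48 / m.totient * (t⁻¹ * (Real.log (t / m))⁻¹) := by
  have hm0 : (0 : ℝ) < m := by positivity
  have hm2 : (2 : ℝ) ≤ m := by exact_mod_cast hm
  have ht0 : 0 < t := by linarith
  have hy : 1 < t / m := (one_lt_div hm0).2 ht
  have htot : (0 : ℝ) < m.totient := by exact_mod_cast Nat.totient_pos.2 (by omega)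
  have hlog : 0 < Real.log (t / m) := Real.log_pos hy
  have h1 : (primesMod t m 1 : ℝ) ≤ 12 * (m / m.totient) * (t / m / Real.log (t / m)) := by
    refine le_trans ?_ (card_prime_mul_add_one_le (by omega) hy)
    rw [primesMod_one_eq hm ht0.le le_rfl]
    exact_mod_cast card_le_card (filter_subset _ _)
  -- Valid since `t ≥ 2`; it turns the sieve constant `12` into `48`.
  have h2 : t ^ 2 / 4 ≤ (t - 1) ^ 2 := by nlinarith
  calc (primesMod t m 1 : ℝ) / (t - 1) ^ 2
      ≤ (12 * (m / m.totient) * (t / m / Real.log (t / m))) / (t ^ 2 / 4) := by gcongr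
    _ = _ := by field_simp; norm_num

theorem totient_mul_integral_primesMod_le {m : ℕ} (hm : 2 ≤ m) {T x : ℝ} (hT : (m : ℝ) < T)
    (hTx : T ≤ x) :
    m.totient * ∫ t in T..x, (primesMod t m 1 : ℝ) / (t - 1) ^ 2 ≤
      48 * (Real.log (Real.log (x / m)) - Real.log (Real.log (T / m))) := by
  have hm0 : (0 : ℝ) < m := by positivity
  have hm2 : (2 : ℝ) ≤ m := by exact_mod_cast hm
  have htot : (0 : ℝ) < m.totient := by exact_mod_cast Nat.totient_pos.2 (by omega)
  have hpos : ∀ t ∈ Set.uIcc T x, 0 < t ∧ 0 < Real.log (t / m) := by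
    intro t ht
    rw [Set.uIcc_of_le hTx] at ht
    have h : (m : ℝ) < t := hT.trans_le ht.1
    exact ⟨by linarith, Real.log_pos ((one_lt_div hm0).2 h)⟩
  have hcont : ContinuousOn (fun t : ℝ => t⁻¹ * (Real.log (t / m))⁻¹) (Set.uIcc T x) := by
    refine ContinuousOn.mul (continuousOn_id.inv₀ fun t ht => (hpos t ht).1.ne')
      (ContinuousOn.inv₀ (ContinuousOn.log (by fun_prop) fun t ht => ?_)
        fun t ht => (hpos t ht).2.ne')
    exact (div_pos (hpos t ht).1 hm0).ne'
  have hder : ∀ t ∈ Set.uIcc T x, HasDerivAt (fun t : ℝ => Real.log (Real.log (t / m)))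
      (t⁻¹ * (Real.log (t / m))⁻¹) t := by
    intro t ht
    obtain ⟨h1, h2⟩ := hpos t ht
    have h := (((hasDerivAt_id' t).div_const (m : ℝ)).log (div_pos h1 hm0).ne').log h2.ne'
    convert h using 1
    field_simp
  have hI := intervalIntegral.integral_eq_sub_of_hasDerivAt hder hcont.intervalIntegrable
  have hle : ∫ t in T..x, (primesMod t m 1 : ℝ) / (t - 1) ^ 2 ≤
      ∫ t in T..x, 48 / m.totient * (t⁻¹ * (Real.log (t / m))⁻¹) := by
    refine intervalIntegral.integral_mono_on hTx
      (intervalIntegrable_primesMod_div m (by linarith) (by linarith))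
      (hcont.intervalIntegrable.const_mul _) fun t ht => ?_
    exact primesMod_div_le hm (hT.trans_le ht.1)
  rw [intervalIntegral.integral_const_mul, hI] at hle
  calc _ ≤ (m.totient : ℝ) * (48 / m.totient *
        (Real.log (Real.log (x / m)) - Real.log (Real.log (T / m)))) := by gcongr
    _ = _ := by field_simp

/-! ### Averaging over dyadic blocks of `m` -/

theorem sum_sumInvPrimes_dyadic_le {ε : ℝ} (hε : 0 < ε) (j : ℕ) :
    ∑ m ∈ Ioc (2 ^ j) (2 ^ (j + 1)), sumInvPrimes m ⌊(m : ℝ) ^ ε⌋₊ ≤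
      200 * (ε + ((j : ℝ) + 1)⁻¹) := by
  set Y : ℝ := 2 ^ (j + 1) with hY
  have hY1 : 1 < Y := one_lt_pow₀ one_lt_two (by omega)
  have hYfl : ⌊Y⌋₊ = 2 ^ (j + 1) := by
    rw [hY]; exact_mod_cast Nat.floor_natCast (R := ℝ) (2 ^ (j + 1))
  set K := ⌊Y ^ ε⌋₊
  have hYε : 1 ≤ Y ^ ε := Real.one_le_rpow hY1.le hε.le
  have hK1 : 1 ≤ K := Nat.le_floor (by simpa using hYε)
  have hlogY : Real.log Y = (j + 1) * Real.log 2 := by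
    rw [hY, Real.log_pow]; push_cast; ring
  have hl2 : (0.69 : ℝ) < Real.log 2 := by linarith [Real.log_two_gt_d9]
  have hj : (0 : ℝ) < (j : ℝ) + 1 := by positivity
  have h1 : ∀ m ∈ Ioc (2 ^ j) (2 ^ (j + 1)), sumInvPrimes m ⌊(m : ℝ) ^ ε⌋₊ ≤
      ∑ k ∈ Icc 1 K, if (m * k + 1).Prime then ((2 : ℝ) ^ j * k)⁻¹ else 0 := by
    intro m hm
    obtain ⟨h1, h2⟩ := mem_Ioc.1 hm
    have h1' : (2 : ℝ) ^ j ≤ m := by exact_mod_cast h1.le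
    have h2' : (m : ℝ) ≤ Y := by rw [hY]; exact_mod_cast h2
    rw [← sum_filter]
    have hsub : {k ∈ Icc 1 ⌊(m : ℝ) ^ ε⌋₊ | (m * k + 1).Prime} ⊆
        {k ∈ Icc 1 K | (m * k + 1).Prime} := by
      refine filter_subset_filter _ (Icc_subset_Icc_right (Nat.floor_le_floor ?_))
      gcongr
    refine (sum_le_sum_of_subset_of_nonneg hsub fun _ _ _ => by positivity).trans ?_
    refine sum_le_sum fun k hk => ?_
    have : (0 : ℝ) < k := by exact_mod_cast (mem_Icc.1 (mem_filter.1 hk).1).1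
    gcongr
  refine (sum_le_sum h1).trans ?_
  -- The roles are exchanged: `k` is now the modulus and the sieve counts `m`, at the cost of a
  -- factor `k / φ(k)`.
  rw [sum_comm]
  have h2 : ∀ k ∈ Icc 1 K, (∑ m ∈ Ioc (2 ^ j) (2 ^ (j + 1)),
      if (m * k + 1).Prime then ((2 : ℝ) ^ j * k)⁻¹ else 0) ≤
      24 / Real.log Y * (k.totient : ℝ)⁻¹ := by
    intro k hk
    have hk1 := (mem_Icc.1 hk).1
    have hk0 : (0 : ℝ) < k := by exact_mod_cast hk1
    have htot : (0 : ℝ) < k.totient := by exact_mod_cast Nat.totient_pos.2 hk1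
    rw [← sum_filter, sum_const, nsmul_eq_mul]
    have hc : (#{m ∈ Ioc (2 ^ j) (2 ^ (j + 1)) | (m * k + 1).Prime} : ℝ) ≤
        12 * (k / k.totient) * (Y / Real.log Y) := by
      refine le_trans ?_ (card_prime_mul_add_one_le hk1 hY1)
      rw [hYfl]
      norm_cast
      refine card_le_card fun m hm => ?_
      obtain ⟨h1, h2⟩ := mem_filter.1 hm
      refine mem_filter.2 ⟨mem_Icc.2 ⟨?_, (mem_Ioc.1 h1).2⟩, by rwa [mul_comm]⟩
      have := (mem_Ioc.1 h1).1
      omega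
    calc _ ≤ 12 * (k / k.totient) * (Y / Real.log Y) * ((2 : ℝ) ^ j * k)⁻¹ := by gcongr
      _ = _ := by
        rw [hY, pow_succ]
        field_simp
        norm_num
  refine (sum_le_sum h2).trans ?_
  rw [← mul_sum]
  have h3 := sum_inv_totient_le K
  have hlogK : Real.log K ≤ ε * Real.log Y := by
    rw [← Real.log_rpow (by linarith)]
    exact Real.log_le_log (by exact_mod_cast hK1) (Nat.floor_le (by positivity))
  have hlY : 0 < Real.log Y := Real.log_pos hY1
  have hinv : (Real.log Y)⁻¹ ≤ 2 * ((j : ℝ) + 1)⁻¹ := by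
    rw [hlogY, mul_inv, mul_comm]
    gcongr
    rw [inv_le_comm₀ (by linarith) (by norm_num)]
    linarith
  have hj' := inv_pos.2 hj
  calc _ ≤ 24 / Real.log Y * (4 * (1 + ε * Real.log Y)) := by gcongr; linarith
    _ = 96 * (Real.log Y)⁻¹ + 96 * ε := by field_simp; ring
    _ ≤ _ := by linarith


/-! ### Summation over the blocks -/

theorem sum_Ioc_one_two_pow (g : ℕ → ℝ) (J : ℕ) :
    ∑ m ∈ Ioc 1 (2 ^ J), g m = ∑ j ∈ range J, ∑ m ∈ Ioc (2 ^ j) (2 ^ (j + 1)), g m := by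
  induction J with
  | zero => simp
  | succ J ih =>
    rw [sum_range_succ, ← ih, sum_Ioc_consecutive _ Nat.one_le_two_pow
      (Nat.pow_le_pow_right two_pos (Nat.le_succ J))]

theorem sum_inv_sqrt_le (J : ℕ) : ∑ j ∈ range J, (√((j : ℝ) + 1))⁻¹ ≤ 2 * √J := by
  induction J with
  | zero => simp
  | succ J ih =>
    rw [sum_range_succ]
    push_cast
    have h0 : (0 : ℝ) ≤ J := Nat.cast_nonneg J
    have h1 : 0 < √((J : ℝ) + 1) := by positivity
    -- The terms are compared with the telescoping differences `2 √(j + 1) - 2 √j`.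
    have h2 := Real.sq_sqrt h0
    have h3 := Real.sq_sqrt (by positivity : (0 : ℝ) ≤ (J : ℝ) + 1)
    have h4 : (√((J : ℝ) + 1))⁻¹ ≤ 2 * √((J : ℝ) + 1) - 2 * √J := by
      rw [inv_le_iff_one_le_mul₀ h1]
      nlinarith [sq_nonneg (√((J : ℝ) + 1) - √J)]
    linarith

theorem sum_inv_add_one_le (J : ℕ) : ∑ j ∈ range J, ((j : ℝ) + 1)⁻¹ ≤ 1 + Real.log J := by
  have := harmonic_le_one_add_log J
  rw [harmonic] at this
  push_cast at this
  exact this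

theorem term_nonneg_and_le {ε x : ℝ} (hε : 0 < ε) (hε1 : ε < 1) (hx : 1 < x) {m : ℕ} (hm : 2 ≤ m)
    (hmx : (m : ℝ) ≤ x ^ (1 - ε)) :
    0 ≤ (m.totient : ℝ) *
      (∫ t in (2 : ℝ)..((m : ℝ) ^ (1 + ε)), (primesMod t m 1 : ℝ) / (t - 1) ^ 2) *
      (∫ t in ((m : ℝ) ^ (1 + ε))..x, (primesMod t m 1 : ℝ) / (t - 1) ^ 2) ∧
    (m.totient : ℝ) *
      (∫ t in (2 : ℝ)..((m : ℝ) ^ (1 + ε)), (primesMod t m 1 : ℝ) / (t - 1) ^ 2) *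
      (∫ t in ((m : ℝ) ^ (1 + ε))..x, (primesMod t m 1 : ℝ) / (t - 1) ^ 2) ≤
    sumInvPrimes m ⌊(m : ℝ) ^ ε⌋₊ *
      (48 * (Real.log ε⁻¹ + 2 * √(Real.log x / Real.log m))) := by
  have hm2 : (2 : ℝ) ≤ m := by exact_mod_cast hm
  have hm0 : (0 : ℝ) < m := by linarith
  have hx0 : 0 < x := by linarith
  set T : ℝ := (m : ℝ) ^ (1 + ε) with hTdef
  have hTm : T = m * (m : ℝ) ^ ε := by rw [hTdef, Real.rpow_add hm0, Real.rpow_one]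
  have hmε : 1 < (m : ℝ) ^ ε := Real.one_lt_rpow (by linarith) hε
  have hmT : (m : ℝ) < T := by rw [hTm]; exact lt_mul_of_one_lt_right hm0 hmε
  have hT2 : 2 ≤ T := by linarith
  have hTx : T ≤ x := by
    calc T ≤ (x ^ (1 - ε)) ^ (1 + ε) := by rw [hTdef]; gcongr
      _ = x ^ (1 - ε ^ 2) := by rw [← Real.rpow_mul hx0.le]; ring_nf
      _ ≤ x ^ (1 : ℝ) := Real.rpow_le_rpow_of_exponent_le hx.le (by nlinarith)
      _ = x := Real.rpow_one x
  have hTdiv : T / m = (m : ℝ) ^ ε := by rw [hTm]; field_simp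
  set A := ∫ t in (2 : ℝ)..T, (primesMod t m 1 : ℝ) / (t - 1) ^ 2
  set B := ∫ t in T..x, (primesMod t m 1 : ℝ) / (t - 1) ^ 2
  have hA0 : 0 ≤ A := intervalIntegral.integral_nonneg hT2 fun t _ => by positivity
  have hB0 : 0 ≤ B := intervalIntegral.integral_nonneg hTx fun t _ => by positivity
  have hA : A ≤ sumInvPrimes m ⌊(m : ℝ) ^ ε⌋₊ := by
    rw [← hTdiv]; exact integral_primesMod_le_sumInvPrimes hm hT2
  have hB := totient_mul_integral_primesMod_le hm hmT hTx
  have hlm : 0 < Real.log m := Real.log_pos (by linarith)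
  have hlx : 0 < Real.log x := Real.log_pos hx
  have hxm : 1 < x / m := (one_lt_div hm0).2 (hmT.trans_le hTx)
  have hlogs : Real.log (Real.log (x / m)) - Real.log (Real.log (T / m)) ≤
      Real.log ε⁻¹ + 2 * √(Real.log x / Real.log m) := by
    rw [hTdiv, Real.log_rpow hm0, Real.log_mul hε.ne' hlm.ne', Real.log_inv]
    have h1 : Real.log (Real.log (x / m)) ≤ Real.log (Real.log x) := by
      refine Real.log_le_log (Real.log_pos hxm) (Real.log_le_log (by linarith) ?_)
      exact div_le_self hx0.le (by linarith)
    have hq : 0 < Real.log x / Real.log m := div_pos hlx hlm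
    -- Applied to `√q` with `q = log x / log m`, this gives `log q ≤ 2 √q`, a loss that stays
    -- harmless after summing over the blocks.
    have h2 := Real.log_le_sub_one_of_pos (Real.sqrt_pos.2 hq)
    rw [Real.log_sqrt hq.le, Real.log_div hlx.ne' hlm.ne'] at h2
    linarith
  have htot : (0 : ℝ) ≤ m.totient := Nat.cast_nonneg _
  refine ⟨by positivity, ?_⟩
  calc (m.totient : ℝ) * A * B = A * (m.totient * B) := by ring
    _ ≤ sumInvPrimes m ⌊(m : ℝ) ^ ε⌋₊ * (48 * (Real.log ε⁻¹ + 2 * √(Real.log x / Real.log m))) := by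
      refine mul_le_mul hA (hB.trans (by gcongr)) (by positivity) (sumInvPrimes_nonneg _ _)

theorem sqrt_log_div_log_le {X : ℝ} (hX : 0 ≤ X) {j m : ℕ} (hm : m ∈ Ioc (2 ^ j) (2 ^ (j + 1))) :
    √(X / Real.log m) ≤ 2 * (√X * (√((j : ℝ) + 1))⁻¹) := by
  have hl2 : (0.69 : ℝ) < Real.log 2 := by linarith [Real.log_two_gt_d9]
  have h1 := (mem_Ioc.1 hm).1
  have hj : (0 : ℝ) < (j : ℝ) + 1 := by positivity
  -- The block `j = 0` is separate: there `2 ^ j` only gives `log m ≥ 0`, but the open left end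
  -- forces `m ≥ 2`.
  have hlog : ((j : ℝ) + 1) / 4 ≤ Real.log m := by
    rcases Nat.eq_zero_or_pos j with rfl | hj
    · have h2 : (2 : ℝ) ≤ m := by exact_mod_cast (by simpa using h1 : 1 < m)
      have := Real.log_le_log (by norm_num) h2
      norm_num
      linarith
    · have h2 : (2 : ℝ) ^ j ≤ m := by exact_mod_cast h1.le
      have := Real.log_le_log (by positivity) h2
      rw [Real.log_pow] at this
      have hj1 : (1 : ℝ) ≤ j := by exact_mod_cast hj
      nlinarith
  rw [Real.sqrt_le_left (by positivity), mul_pow, mul_pow, inv_pow, Real.sq_sqrt hX,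
    Real.sq_sqrt hj.le]
  calc X / Real.log m ≤ X / (((j : ℝ) + 1) / 4) := by gcongr
    _ = _ := by field_simp; norm_num

theorem abs_crossSum_le {ε x : ℝ} (hε : 0 < ε) (hε1 : ε < 1) (hx : 1 < x) {J : ℕ}
    (hJ : x ≤ 2 ^ J) :
    |crossSum ε x| ≤ ∑ j ∈ range J, 200 * (ε + ((j : ℝ) + 1)⁻¹) *
      (48 * (Real.log ε⁻¹ + 4 * (√(Real.log x) * (√((j : ℝ) + 1))⁻¹))) := by
  have hx0 : 0 < x := by linarith
  have hL : 0 ≤ Real.log ε⁻¹ := Real.log_nonneg (one_le_inv_iff₀.2 ⟨hε, hε1.le⟩)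
  have hX : 0 ≤ Real.log x := Real.log_nonneg hx.le
  set M := ⌊x ^ (1 - ε)⌋₊
  have hM1 : 1 ≤ M := Nat.le_floor (by
    simpa using Real.one_le_rpow hx.le (by linarith : (0 : ℝ) ≤ 1 - ε))
  have hMx : (M : ℝ) ≤ x ^ (1 - ε) := Nat.floor_le (by positivity)
  have hMJ : M ≤ 2 ^ J := by
    have : (M : ℝ) ≤ 2 ^ J := hMx.trans <|
      (Real.rpow_le_rpow_of_exponent_le hx.le (by linarith)).trans
        ((Real.rpow_one x).le.trans hJ)
    exact_mod_cast this
  have hsplit : Icc 1 M = insert 1 (Ioc 1 M) := by ext; simp; omega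
  have hterm : ∀ m ∈ Ioc 1 M, 2 ≤ m ∧ (m : ℝ) ≤ x ^ (1 - ε) := fun m hm =>
    ⟨(mem_Ioc.1 hm).1, (Nat.cast_le.2 (mem_Ioc.1 hm).2).trans hMx⟩
  have hcs : crossSum ε x = ∑ m ∈ Ioc 1 M, (m.totient : ℝ) *
      (∫ t in (2 : ℝ)..((m : ℝ) ^ (1 + ε)), (primesMod t m 1 : ℝ) / (t - 1) ^ 2) *
      (∫ t in ((m : ℝ) ^ (1 + ε))..x, (primesMod t m 1 : ℝ) / (t - 1) ^ 2) := by
    rw [crossSum, hsplit, sum_insert (by simp)]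
    simp only [Nat.cast_one, Real.one_rpow, integral_two_one_primesMod, mul_zero, zero_mul,
      zero_add]
  have hnn : 0 ≤ crossSum ε x := by
    rw [hcs]
    exact sum_nonneg fun m hm =>
      (term_nonneg_and_le hε hε1 hx (hterm m hm).1 (hterm m hm).2).1
  rw [abs_of_nonneg hnn, hcs]
  have hg : ∀ m : ℕ, 0 ≤ sumInvPrimes m ⌊(m : ℝ) ^ ε⌋₊ *
      (48 * (Real.log ε⁻¹ + 2 * √(Real.log x / Real.log m))) := fun m =>
    mul_nonneg (sumInvPrimes_nonneg _ _) (by positivity)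
  calc _ ≤ ∑ m ∈ Ioc 1 M, sumInvPrimes m ⌊(m : ℝ) ^ ε⌋₊ *
      (48 * (Real.log ε⁻¹ + 2 * √(Real.log x / Real.log m))) := sum_le_sum fun m hm =>
        (term_nonneg_and_le hε hε1 hx (hterm m hm).1 (hterm m hm).2).2
    _ ≤ ∑ m ∈ Ioc 1 (2 ^ J), sumInvPrimes m ⌊(m : ℝ) ^ ε⌋₊ *
      (48 * (Real.log ε⁻¹ + 2 * √(Real.log x / Real.log m))) :=
        sum_le_sum_of_subset_of_nonneg (Ioc_subset_Ioc_right hMJ) fun m _ _ => hg m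
    _ ≤ _ := by
      rw [sum_Ioc_one_two_pow]
      refine sum_le_sum fun j _ => ?_
      calc _ ≤ ∑ m ∈ Ioc (2 ^ j) (2 ^ (j + 1)), sumInvPrimes m ⌊(m : ℝ) ^ ε⌋₊ *
          (48 * (Real.log ε⁻¹ + 4 * (√(Real.log x) * (√((j : ℝ) + 1))⁻¹))) := by
            refine sum_le_sum fun m hm => ?_
            have := sqrt_log_div_log_le hX hm
            refine mul_le_mul_of_nonneg_left ?_ (sumInvPrimes_nonneg _ _)
            linarith
        _ ≤ _ := by
            rw [← sum_mul]
            exact mul_le_mul_of_nonneg_right (sum_sumInvPrimes_dyadic_le hε j) (by positivity)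

theorem sum_dyadic_weights_le {ε L X : ℝ} (hε : 0 < ε) (hL : 0 ≤ L) (J : ℕ) :
    ∑ j ∈ range J, 200 * (ε + ((j : ℝ) + 1)⁻¹) *
      (48 * (L + 4 * (√X * (√((j : ℝ) + 1))⁻¹))) ≤
    9600 * (ε * L * J + 8 * ε * (√X * √J) + (L + 4 * √X) * (1 + Real.log J)) := by
  have hterm : ∀ j ∈ range J, 200 * (ε + ((j : ℝ) + 1)⁻¹) *
      (48 * (L + 4 * (√X * (√((j : ℝ) + 1))⁻¹))) ≤
      9600 * (ε * L + 4 * ε * √X * (√((j : ℝ) + 1))⁻¹ + (L + 4 * √X) * ((j : ℝ) + 1)⁻¹) := by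
    intro j _
    have h1 : (√((j : ℝ) + 1))⁻¹ ≤ 1 :=
      inv_le_one_of_one_le₀ (Real.one_le_sqrt.2 (by linarith [Nat.cast_nonneg (α := ℝ) j]))
    have h2 : 0 ≤ ((j : ℝ) + 1)⁻¹ := by positivity
    -- In the cross term the factor `1 / √(j + 1)` is dropped, leaving a harmonic sum.
    have h3 := mul_le_mul_of_nonneg_left h1 (mul_nonneg (Real.sqrt_nonneg X) h2)
    linarith
  refine (sum_le_sum hterm).trans ?_
  rw [← mul_sum, sum_add_distrib, sum_add_distrib, sum_const, card_range, nsmul_eq_mul,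
    ← mul_sum, ← mul_sum]
  have h1 := mul_le_mul_of_nonneg_left (sum_inv_sqrt_le J)
    (by positivity : 0 ≤ 4 * ε * √X)
  have h2 := mul_le_mul_of_nonneg_left (sum_inv_add_one_le J)
    (by positivity : 0 ≤ L + 4 * √X)
  linarith

/-! ### Lower order terms and conclusion -/

theorem eventually_lower_order_le {ε : ℝ} (hε : 0 < ε) (L : ℝ) :
    ∀ᶠ X : ℝ in Filter.atTop, (L + 4 * √X) * (1 + Real.log (3 * X)) ≤ ε * X := by
  have hs : Filter.Tendsto (fun X : ℝ => X ^ (1 / 4 : ℝ)) Filter.atTop Filter.atTop :=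
    tendsto_rpow_atTop (by norm_num)
  filter_upwards [Filter.eventually_ge_atTop 1, hs.eventually_ge_atTop (40 / ε),
    hs.eventually_ge_atTop |L|] with X hX h1 h2
  -- In terms of `u` the left side is `O(u ^ 3)` against `ε * u ^ 4`; this fixes how `x₀` depends on
  -- `ε`.
  set u := X ^ (1 / 4 : ℝ) with hu
  have hX0 : 0 < X := by linarith
  have hu1 : 1 ≤ u := Real.one_le_rpow hX (by norm_num)
  have hu2 : √X = u ^ 2 := by
    rw [Real.sqrt_eq_rpow, hu, ← Real.rpow_natCast, ← Real.rpow_mul hX0.le]; norm_num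
  have hu4 : X = u ^ 4 := by
    rw [hu, ← Real.rpow_natCast, ← Real.rpow_mul hX0.le]; norm_num
  have hlog : 1 + Real.log (3 * X) ≤ 8 * u := by
    rw [Real.log_mul (by norm_num) hX0.ne', hu4, Real.log_pow]
    have a1 := Real.log_le_sub_one_of_pos (by linarith : 0 < u)
    have a2 := Real.log_le_sub_one_of_pos (by norm_num : (0 : ℝ) < 3)
    push_cast
    linarith
  have hlog0 : 0 ≤ 1 + Real.log (3 * X) := by
    have := Real.log_nonneg (by linarith : 1 ≤ 3 * X)
    linarith
  have hL : L + 4 * √X ≤ 5 * u ^ 2 := by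
    rw [hu2]
    nlinarith [le_abs_self L]
  have h3 : 40 ≤ ε * u := by rwa [div_le_iff₀' hε] at h1
  calc (L + 4 * √X) * (1 + Real.log (3 * X)) ≤ 5 * u ^ 2 * (8 * u) := by gcongr
    _ = 40 * u ^ 3 := by ring
    _ ≤ ε * u * u ^ 3 := by gcongr
    _ = ε * X := by rw [hu4]; ring

theorem proposition3 :
    ∃ C : ℝ, 0 < C ∧ ∃ ε₀ : ℝ, 0 < ε₀ ∧ ε₀ < 1 ∧
      ∀ ε : ℝ, 0 < ε → ε < ε₀ →
        ∃ x₀ : ℝ, ∀ x : ℝ, x₀ ≤ x →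
          |crossSum ε x| ≤
            C * (ε * (Real.log ε⁻¹) ^ 2 * Real.log x + (Real.log (Real.log x)) ^ 2) := by
  -- `1/3 < 1/e` ensures `log ε⁻¹ ≥ 1`. The `20` is `3 + 16 + 1`, from `hb1`, `hb2`, `hb3`.
  refine ⟨9600 * 20, by norm_num, 1 / 3, by norm_num, by norm_num, fun ε hε hε3 => ?_⟩
  have hL : 1 ≤ Real.log ε⁻¹ := by
    rw [Real.le_log_iff_exp_le (inv_pos.2 hε), le_inv_comm₀ (Real.exp_pos 1) hε]
    have h := Real.exp_one_lt_d9
    refine hε3.le.trans ?_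
    rw [one_div]
    exact inv_anti₀ (Real.exp_pos 1) (by linarith)
  set L := Real.log ε⁻¹
  obtain ⟨x₀, hx₀⟩ := Filter.eventually_atTop.1 <|
    (Real.tendsto_log_atTop.eventually (eventually_lower_order_le hε L)).and
      ((Real.tendsto_log_atTop.eventually_ge_atTop 1).and (Filter.eventually_gt_atTop 1))
  refine ⟨x₀, fun x hx => ?_⟩
  obtain ⟨hlow, hX1, hx1⟩ := hx₀ x hx
  have hl2 : (0.69 : ℝ) < Real.log 2 := by linarith [Real.log_two_gt_d9]
  set X := Real.log x with hXdef
  set J := ⌈X / Real.log 2⌉₊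
  have hJ1 : X / Real.log 2 ≤ J := Nat.le_ceil _
  have hJ2 : (J : ℝ) ≤ 3 * X := by
    have h1 := (Nat.ceil_lt_add_one (by positivity : 0 ≤ X / Real.log 2)).le
    have h2 : X / Real.log 2 ≤ 2 * X := by
      rw [div_le_iff₀ (by linarith)]
      nlinarith
    linarith
  have hJpos : (0 : ℝ) < J := lt_of_lt_of_le (by positivity) hJ1
  have hJx : x ≤ 2 ^ J := by
    rw [← Real.log_le_log_iff (by linarith) (by positivity), Real.log_pow]
    exact (div_le_iff₀ (by linarith)).1 hJ1
  have hsqrt : √X * √J ≤ 2 * X := by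
    rw [← Real.sqrt_mul (by linarith)]
    refine Real.sqrt_le_iff.2 ⟨by linarith, ?_⟩
    nlinarith
  have hlogJ : Real.log J ≤ Real.log (3 * X) := Real.log_le_log hJpos hJ2
  have hLX : 0 ≤ L + 4 * √X := by positivity
  have hεX : 0 ≤ ε * X := by positivity
  have hb1 : ε * L * J ≤ 3 * (ε * L ^ 2 * X) := by
    calc ε * L * J ≤ ε * L * (3 * X) := by gcongr
      _ = 3 * (ε * X) * L := by ring
      _ ≤ 3 * (ε * X) * L ^ 2 := by gcongr; exact le_self_pow₀ hL (by norm_num)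
      _ = _ := by ring
  have hL2 : ε * X ≤ ε * L ^ 2 * X := by
    calc ε * X = ε * X * 1 := (mul_one _).symm
      _ ≤ ε * X * L ^ 2 := by gcongr; exact one_le_pow₀ hL
      _ = _ := by ring
  have hb2 : 8 * ε * (√X * √J) ≤ 16 * (ε * X) := by
    calc 8 * ε * (√X * √J) ≤ 8 * ε * (2 * X) := by gcongr
      _ = _ := by ring
  have hb3 : (L + 4 * √X) * (1 + Real.log J) ≤ ε * X :=
    le_trans (by gcongr) hlow
  calc |crossSum ε x| ≤ _ := abs_crossSum_le hε (by linarith) hx1 hJx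
    _ ≤ _ := sum_dyadic_weights_le hε (by linarith) J
    _ ≤ 9600 * (20 * (ε * L ^ 2 * X)) := by gcongr; linarith
    _ ≤ 9600 * 20 * (ε * L ^ 2 * X + (Real.log X) ^ 2) := by nlinarith [sq_nonneg (Real.log X)]
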